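/- For a finite set $D$, let $\mathrm{Sym}(D)$ be the group of all permutations of $D$ and $\mathrm{Alt}(D)$ its subgroup of even permutations. A fixed set for a subgroup $G$ of $\mathrm{Sym}(D)$ is a subset $\Delta \subseteq D$ such that every $g \in G$ maps $\Delta$ to $\Delta$; then $G^{\Delta}$ denotes the subgroup of $\mathrm{Sym}(\Delta)$ consisting of the restrictions $g|_{\Delta}$, $g \in G$. Let $k$ be a natural number. There is a natural number $N \ge k$, depending only on $k$, such that for every finite set $D$ with $|D| = n \ge N$ and every subgroup $G$ of $\mathrm{Sym}(D)$ with $|G| \ge (n-k)!$, there is a fixed set $\Delta$ for $G$ with $|\Delta| \ge n-k$ such that $G^{\Delta}$ contains $\mathrm{Alt}(\Delta)$. -/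

import Mathlib

/-- `Δ` is a fixed set for the permutation group `G`: every `g ∈ G` maps `Δ` to `Δ`. -/
def IsFixedSet {D : Type*} (G : Subgroup (Equiv.Perm D)) (Δ : Finset D) : Prop :=
  ∀ g ∈ G, ∀ x ∈ Δ, g x ∈ Δ

/-- The group `G^Δ` of permutations of `Δ` that are restrictions to `Δ` of elements of `G`.
For a fixed set `Δ` of `G`, every element of `G` restricts to `Δ`, so that this is the image
of `G` in `Sym(Δ)`. -/
def inducedGroup {D : Type*} (G : Subgroup (Equiv.Perm D)) (Δ : Finset D) :
    Subgroup (Equiv.Perm Δ) where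
  carrier := {σ | ∃ g ∈ G, ∀ x : Δ, ((σ x : Δ) : D) = g x}
  one_mem' := ⟨1, G.one_mem, fun _ => rfl⟩
  mul_mem' := by
    rintro σ τ ⟨g, hg, hσ⟩ ⟨h, hh, hτ⟩
    refine ⟨g * h, G.mul_mem hg hh, fun x => ?_⟩
    rw [Equiv.Perm.mul_apply, Equiv.Perm.mul_apply, hσ, hτ]
  inv_mem' := by
    rintro σ ⟨g, hg, hσ⟩
    refine ⟨g⁻¹, G.inv_mem hg, fun x => ?_⟩
    rw [Equiv.Perm.eq_inv_iff_eq, ← hσ]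
    exact congrArg Subtype.val (σ.apply_symm_apply x)

/-! A maximal set T without 3-cycles of G is small. By Bochert's argument it has a subset W of size
w ≥ |T|/2 with G ∩ Sym(W) trivial, so |G| w! ≤ n! ≤ (n-k)! n^k, whence w! ≤ n^k and w is far below
√n. Each point outside T completes a 3-cycle with two points of T; by pigeonhole many share one
pair, and these cycles generate all 3-cycles on a set of at least k+3 points.

Let C be a largest set all of whose 3-cycles lie in G. Overlapping sets of this kind can be
enlarged, so any image of C under G that meets C equals C. Hence the stabilizer of a point of C
preserves C, and |G| ≤ n!/binom(n-1, |C|-1). For k+3 ≤ |C| < n-k this binomial exceeds n^k, which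
contradicts |G| ≥ (n-k)!. So |C| ≥ n-k > n/2, every image of C meets C, and C is the fixed set. -/

open Equiv Equiv.Perm

/-! ### Sets with all, or none, of their 3-cycles in G -/

section ThreeCycles

variable {D : Type*} [DecidableEq D] {G : Subgroup (Perm D)}

/-- The 3-cycle `a ↦ b ↦ c ↦ a` belongs to `G`. -/
def HasThreeCycle (G : Subgroup (Perm D)) (a b c : D) : Prop :=
  swap a b * swap b c ∈ G

/-- All 3-cycles on points of `C` belong to `G`. -/
def ThreeCycleClosed (G : Subgroup (Perm D)) (C : Finset D) : Prop :=
  ∀ a ∈ C, ∀ b ∈ C, ∀ c ∈ C, a ≠ b → b ≠ c → a ≠ c → HasThreeCycle G a b c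

/-- No 3-cycle on points of `T` belongs to `G`. -/
def ThreeCycleFree (G : Subgroup (Perm D)) (T : Finset D) : Prop :=
  ∀ a ∈ T, ∀ b ∈ T, ∀ c ∈ T, a ≠ b → b ≠ c → a ≠ c → ¬ HasThreeCycle G a b c

theorem HasThreeCycle.reverse {a b c : D} (h : HasThreeCycle G a b c) :
    HasThreeCycle G c b a := by
  have := G.inv_mem h
  rwa [mul_inv_rev, swap_inv, swap_inv, swap_comm b c, swap_comm a b] at this

theorem HasThreeCycle.rotate {a b c : D} (h : HasThreeCycle G a b c) (hab : a ≠ b)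
    (hbc : b ≠ c) (hac : a ≠ c) : HasThreeCycle G b c a := by
  have : swap a b * swap b c = swap b c * swap c a := by
    ext x
    simp only [Perm.mul_apply, swap_apply_def]
    grind
  rwa [HasThreeCycle, ← this]

theorem HasThreeCycle.conj {a b c : D} (h : HasThreeCycle G a b c) {g : Perm D} (hg : g ∈ G) :
    HasThreeCycle G (g a) (g b) (g c) := by
  have := G.mul_mem (G.mul_mem hg h) (G.inv_mem hg)
  rw [HasThreeCycle, swap_apply_apply, swap_apply_apply]
  convert this using 1
  group

/-- Conjugation of one 3-cycle by another one that shares exactly one point with it. -/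
theorem HasThreeCycle.conj_of_disjoint {x y z u v : D} (h : HasThreeCycle G y u v)
    (h' : HasThreeCycle G y x z) (hyx : y ≠ x) (hxu : x ≠ u)
    (hxv : x ≠ v) (hzu : z ≠ u) (hzv : z ≠ v) (hyu : y ≠ u) (hyv : y ≠ v) (hyz : y ≠ z) :
    HasThreeCycle G x u v := by
  have := h.conj h'
  simp only [Perm.mul_apply] at this
  rwa [swap_apply_of_ne_of_ne hyx hyz, swap_apply_left,
    swap_apply_of_ne_of_ne hxu.symm hzu.symm, swap_apply_of_ne_of_ne hyu.symm hxu.symm,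
    swap_apply_of_ne_of_ne hxv.symm hzv.symm, swap_apply_of_ne_of_ne hyv.symm hxv.symm] at this

/-- The 3-cycles through two fixed points generate all 3-cycles. -/
theorem threeCycleClosed_of_star {a b : D} {C : Finset D} (hab : a ≠ b)
    (h : ∀ x ∈ C, x ≠ a → x ≠ b → HasThreeCycle G a b x) : ThreeCycleClosed G C := by
  have h2 : ∀ x ∈ C, x ≠ a → x ≠ b → HasThreeCycle G b a x := fun x hx hxa hxb =>
    (h x hx hxa hxb).reverse.rotate hxb hab.symm hxa
  have hb : ∀ x ∈ C, x ≠ a → x ≠ b → ∀ y ∈ C, y ≠ a → y ≠ b → x ≠ y →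
      HasThreeCycle G b y x := by
    -- Conjugating (a b x) by (a b y) gives (b y x).
    intro x hx hxa hxb y hy hya hyb hxy
    have := (h x hx hxa hxb).conj (h y hy hya hyb)
    simpa [swap_apply_of_ne_of_ne, *, hab.symm, hya.symm, hyb.symm] using this
  have ha : ∀ x ∈ C, x ≠ a → x ≠ b → ∀ y ∈ C, y ≠ a → y ≠ b → x ≠ y →
      HasThreeCycle G a y x := by
    intro x hx hxa hxb y hy hya hyb hxy
    have := (h2 x hx hxa hxb).conj (h2 y hy hya hyb)
    simpa [swap_apply_of_ne_of_ne, *, hab.symm, hya.symm, hyb.symm] using this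
  have ho : ∀ x ∈ C, x ≠ a → x ≠ b → ∀ y ∈ C, y ≠ a → y ≠ b → ∀ z ∈ C, z ≠ a → z ≠ b →
      x ≠ y → x ≠ z → y ≠ z → HasThreeCycle G z y x := by
    intro x hx hxa hxb y hy hya hyb z hz hza hzb hxy hxz hyz
    have := (hb x hx hxa hxb y hy hya hyb hxy).conj (h z hz hza hzb)
    simpa [swap_apply_of_ne_of_ne, *, hab.symm, hza.symm, hzb.symm] using this
  intro p hp q hq r hr hpq hqr hpr
  have hrot : HasThreeCycle G q r p → HasThreeCycle G p q r := fun H =>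
    (H.rotate hqr hpr.symm hpq.symm).rotate hpr.symm hpq hqr.symm
  have hrot' : HasThreeCycle G r p q → HasThreeCycle G p q r := fun H =>
    H.rotate hpr.symm hpq hqr.symm
  by_cases hpa : p = a <;> by_cases hpb : p = b <;> by_cases hqa : q = a <;>
    by_cases hqb : q = b <;> by_cases hra : r = a <;> by_cases hrb : r = b <;> grind

theorem ThreeCycleClosed.insert_of_hasThreeCycle {C : Finset D} (hC : ThreeCycleClosed G C) {x y z : D}
    (hx : x ∉ C) (hy : y ∈ C) (hz : z ∈ C) (hyz : y ≠ z) (h : HasThreeCycle G y z x) :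
    ThreeCycleClosed G (insert x C) := by
  refine threeCycleClosed_of_star hyz fun w hw hwy hwz => ?_
  rcases Finset.mem_insert.1 hw with rfl | hw
  · exact h
  · exact hC y hy z hz w hw hyz hwz.symm hwy.symm

theorem ThreeCycleClosed.map {C : Finset D} (hC : ThreeCycleClosed G C) {g : Perm D}
    (hg : g ∈ G) : ThreeCycleClosed G (C.map g.toEmbedding) := by
  intro a ha b hb c hc hab hbc hac
  simp only [Finset.mem_map, Equiv.coe_toEmbedding] at ha hb hc
  obtain ⟨a, ha, rfl⟩ := ha
  obtain ⟨b, hb, rfl⟩ := hb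
  obtain ⟨c, hc, rfl⟩ := hc
  exact (hC a ha b hb c hc (ne_of_apply_ne _ hab) (ne_of_apply_ne _ hbc)
    (ne_of_apply_ne _ hac)).conj hg

/-- Closed sets that overlap can be enlarged. -/
theorem ThreeCycleClosed.exists_insert {C C' : Finset D} (hC : ThreeCycleClosed G C)
    (hC' : ThreeCycleClosed G C') (h3 : 3 ≤ C.card) (h3' : 3 ≤ C'.card) {x y : D} (hyC : y ∈ C)
    (hyC' : y ∈ C') (hxC' : x ∈ C') (hxC : x ∉ C) : ThreeCycleClosed G (insert x C) := by
  have hyx : y ≠ x := fun h => hxC (h ▸ hyC)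
  obtain ⟨z, hz, hzxy⟩ : ∃ z ∈ C', z ∉ ({x, y} : Finset D) :=
    Finset.exists_mem_notMem_of_card_lt_card (Finset.card_le_two.trans_lt (by omega))
  simp only [Finset.mem_insert, Finset.mem_singleton, not_or] at hzxy
  by_cases hzC : z ∈ C
  · exact hC.insert_of_hasThreeCycle hxC hyC hzC (Ne.symm hzxy.2)
      (hC' y hyC' z hz x hxC' (Ne.symm hzxy.2) hzxy.1 hyx)
  -- Here (y x z) moves only y within C, so it conjugates (y u v) to (x u v).
  · obtain ⟨u, hu, v, hv, huv⟩ : ∃ u ∈ C.erase y, ∃ v ∈ C.erase y, u ≠ v :=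
      Finset.one_lt_card.1 (by rw [Finset.card_erase_of_mem hyC]; omega)
    obtain ⟨huy, hu⟩ := Finset.mem_erase.1 hu
    obtain ⟨hvy, hv⟩ := Finset.mem_erase.1 hv
    have hxu : x ≠ u := fun h => hxC (h ▸ hu)
    have hxv : x ≠ v := fun h => hxC (h ▸ hv)
    refine hC.insert_of_hasThreeCycle hxC hu hv huv (HasThreeCycle.rotate ?_ hxu huv hxv)
    exact (hC y hyC u hu v hv huy.symm huv hvy.symm).conj_of_disjoint
      (hC' y hyC' x hxC' z hz hyx (Ne.symm hzxy.1) (Ne.symm hzxy.2)) hyx hxu hxv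
      (fun h => hzC (h ▸ hu)) (fun h => hzC (h ▸ hv)) huy.symm hvy.symm (Ne.symm hzxy.2)

theorem ThreeCycleClosed.alternatingGroup_le_inducedGroup {C : Finset D}
    (hC : ThreeCycleClosed G C) : alternatingGroup C ≤ inducedGroup G C := by
  rw [← closure_three_cycles_eq_alternating, Subgroup.closure_le]
  intro σ hσ
  obtain ⟨a, ha⟩ : σ.support.Nonempty := by
    rw [← Finset.card_pos, IsThreeCycle.card_support hσ]
    exact three_pos
  obtain ⟨b, hb⟩ : ∃ b, b = σ a := ⟨_, rfl⟩
  obtain ⟨c, hc⟩ : ∃ c, c = σ b := ⟨_, rfl⟩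
  have hnodup := (IsThreeCycle.nodup_iff_mem_support hσ).2 ha
  have hσ' := (IsThreeCycle.eq_swap_mul_swap_iff_mem_support hσ).2 ha
  rw [← hb, ← hc] at hnodup hσ'
  simp only [List.nodup_cons, List.mem_cons, List.not_mem_nil, or_false, not_or,
    not_false_eq_true, List.nodup_nil, and_true] at hnodup
  obtain ⟨⟨hab, hac⟩, hbc⟩ := hnodup
  refine ⟨_, hC a a.2 b b.2 c c.2 (Subtype.coe_ne_coe.2 hab) (Subtype.coe_ne_coe.2 hbc)
    (Subtype.coe_ne_coe.2 hac), fun x => ?_⟩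
  have key : ∀ u v w : C, ((swap u v w : C) : D) = swap (u : D) v w :=
    fun u v w => (Subtype.coe_injective.swap_apply u v w).symm
  rw [hσ', Perm.mul_apply, Perm.mul_apply, key, key]

/-- The commutator of two permutations whose supports meet in one point is a 3-cycle. -/
theorem hasThreeCycle_of_supports_inter {x y : Perm D} (hx : x ∈ G) (hy : y ∈ G) {a : D}
    (hxa : x a ≠ a) (hya : y a ≠ a) (h : ∀ d, d ≠ a → x d = d ∨ y d = d) :
    HasThreeCycle G a (x a) (y a) := by
  have : swap a (x a) * swap (x a) (y a) = x * y * x⁻¹ * y⁻¹ := by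
    rw [eq_mul_inv_iff_mul_eq, eq_mul_inv_iff_mul_eq]
    have hxx : x (x a) ≠ x a := fun e => hxa (x.injective e)
    have hyy : y (y a) ≠ y a := fun e => hya (y.injective e)
    have hyx : y (x a) = x a := (h _ hxa).resolve_left hxx
    have hxy : x (y a) = y a := (h _ hya).resolve_right hyy
    have hne : x a ≠ y a := fun e => hyy (by rw [← e, hyx])
    ext d
    simp only [Perm.mul_apply]
    rcases eq_or_ne d a with rfl | hd
    · rw [hyx, hxy, swap_apply_left, swap_apply_of_ne_of_ne hya hne.symm]
    by_cases hxd : x d = d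
    · rw [hxd]
      rcases eq_or_ne (y d) a with hyd | hyd
      · rw [hyd, swap_apply_of_ne_of_ne hxa.symm hya.symm, swap_apply_left]
      · have h1 : x (y d) = y d := by
          rcases h _ hyd with h1 | h1
          · exact h1
          · rw [y.injective h1, hxd]
        have h2 : y d ≠ x a := fun e => hxx (y.injective (e.trans hyx.symm) ▸ hxd)
        have h3 : y d ≠ y a := fun e => hd (y.injective e)
        rw [h1, swap_apply_of_ne_of_ne h2 h3, swap_apply_of_ne_of_ne hyd h2]
    · have hyd : y d = d := (h d hd).resolve_left hxd
      rw [hyd]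
      rcases eq_or_ne (x d) a with hxd' | hxd'
      · rw [hxd', swap_apply_right, swap_apply_right]
      · have h1 : y (x d) = x d := (h _ hxd').resolve_left fun e => hxd (x.injective e)
        have h2 : x d ≠ x a := fun e => hd (x.injective e)
        have h3 : x d ≠ y a := fun e => hyy (by rw [← e, h1])
        rw [h1, swap_apply_of_ne_of_ne h2 h3, swap_apply_of_ne_of_ne hxd' h2]
  rw [HasThreeCycle, this]
  exact G.mul_mem (G.mul_mem (G.mul_mem hx hy) (G.inv_mem hx)) (G.inv_mem hy)

/-- Bochert's argument: a set without 3-cycles of `G` has a subset of at least half its size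
on which no nontrivial element of `G` is supported. -/
theorem ThreeCycleFree.exists_subset {T : Finset D} (hT : ThreeCycleFree G T) :
    ∃ W ⊆ T, T.card ≤ 2 * W.card ∧ ∀ g ∈ G, (∀ d, d ∉ W → g d = d) → g = 1 := by
  classical
  let S := T.powerset.filter fun W => ∀ g ∈ G, (∀ d, d ∉ W → g d = d) → g = 1
  have hS : S.Nonempty := ⟨∅, by
    simp only [S, Finset.mem_filter, Finset.empty_mem_powerset, true_and]
    exact fun g _ h => Perm.ext fun d => h d (Finset.notMem_empty d)⟩
  obtain ⟨W, hWS, hmax⟩ := S.exists_max_image Finset.card hS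
  obtain ⟨hWT, hW⟩ : W ⊆ T ∧ ∀ g ∈ G, (∀ d, d ∉ W → g d = d) → g = 1 := by
    simpa [S] using hWS
  have key : ∀ W' ⊆ T, W.card < W'.card →
      ∃ g ∈ G, (∀ d, d ∉ W' → g d = d) ∧ g ≠ 1 := by
    intro W' hW' hlt
    by_contra! hcon
    exact absurd (hmax W' (by simpa [S] using ⟨hW', hcon⟩)) (by omega)
  refine ⟨W, hWT, ?_, hW⟩
  by_contra! hlt
  -- Both T \ W and W ∪ {a} are larger than W, so each supports a nontrivial element; the two
  -- supports meet only in a.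
  obtain ⟨x, hx, hxs, hx1⟩ := key (T \ W) Finset.sdiff_subset (by
    rw [Finset.card_sdiff_of_subset hWT]; omega)
  obtain ⟨a, ha⟩ : ∃ a, x a ≠ a := by
    by_contra! h
    exact hx1 (Perm.ext h)
  have haTW : a ∈ T \ W := by
    by_contra h
    exact ha (hxs a h)
  obtain ⟨haT, haW⟩ := Finset.mem_sdiff.1 haTW
  obtain ⟨y, hy, hys, hy1⟩ := key (insert a W) (Finset.insert_subset haT hWT) (by
    rw [Finset.card_insert_of_notMem haW]; omega)
  have hya : y a ≠ a := by
    refine fun h => hy1 (hW y hy fun d hd => ?_)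
    by_cases hda : d = a
    · rw [hda, h]
    · exact hys d (by simp [hda, hd])
  have hdisj : ∀ d, d ≠ a → x d = d ∨ y d = d := by
    intro d hda
    by_cases hd : d ∈ W
    · exact Or.inl (hxs d (by simp [hd]))
    · exact Or.inr (hys d (by simp [hda, hd]))
  have hxT : x a ∈ T := by
    by_contra h
    exact ha (x.injective (hxs _ fun h' => h (Finset.mem_sdiff.1 h').1))
  have hyT : y a ∈ T := by
    by_contra h
    exact hya (y.injective (hys _ fun h' => h (Finset.insert_subset haT hWT h')))
  have hxy : x a ≠ y a := by
    intro h
    rcases hdisj (x a) ha with h' | h'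
    · exact ha (x.injective h')
    · rw [h] at h'
      exact hya (y.injective h')
  exact hT a haT _ hxT _ hyT ha.symm hxy hya.symm
    (hasThreeCycle_of_supports_inter hx hy ha hya hdisj)

end ThreeCycles

/-! ### Counting: order bounds and pigeonhole -/

section Counting

variable {D : Type*} [Fintype D] [DecidableEq D] {G : Subgroup (Perm D)}

/-- G and Sym(W) meet trivially, so their products are pairwise distinct. -/
theorem card_mul_factorial_le {W : Finset D}
    (hW : ∀ g ∈ G, (∀ d, d ∉ W → g d = d) → g = 1) :
    Nat.card G * W.card.factorial ≤ (Fintype.card D).factorial := by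
  have hinj : Function.Injective
      (fun p : G × Perm W => (p.1 : Perm D) * Perm.ofSubtype p.2) := by
    rintro ⟨g, σ⟩ ⟨g', σ'⟩ h
    simp only at h
    have h1 : (g' : Perm D)⁻¹ * g = Perm.ofSubtype (σ' * σ⁻¹) := by
      rw [map_mul, map_inv, eq_mul_inv_iff_mul_eq, mul_assoc, h, inv_mul_cancel_left]
    have h2 : (g' : Perm D)⁻¹ * g = 1 :=
      hW _ (G.mul_mem (G.inv_mem g'.2) g.2) fun d hd => by
        rw [h1, Perm.ofSubtype_apply_of_not_mem _ hd]
    have h3 : g = g' := Subtype.ext (inv_mul_eq_one.1 h2).symm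
    subst h3
    exact Prod.ext rfl (Perm.ofSubtype_injective (mul_left_cancel h))
  have := Nat.card_le_card_of_injective _ hinj
  rwa [Nat.card_prod, Nat.card_eq_fintype_card (α := Perm W),
    Nat.card_eq_fintype_card (α := Perm D), Fintype.card_perm, Fintype.card_perm,
    Fintype.card_coe] at this

theorem exists_threeCycleFree_forall_notMem (G : Subgroup (Perm D)) :
    ∃ T : Finset D, ThreeCycleFree G T ∧
      ∀ x ∉ T, ∃ a ∈ T, ∃ b ∈ T, a ≠ b ∧ HasThreeCycle G a b x := by
  classical
  obtain ⟨T, hTS, hmax⟩ := (Finset.univ.filter fun T : Finset D => ThreeCycleFree G T)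
    |>.exists_max_image Finset.card ⟨∅, Finset.mem_filter.2 ⟨Finset.mem_univ _, by simp [ThreeCycleFree]⟩⟩
  have hT : ThreeCycleFree G T := (Finset.mem_filter.1 hTS).2
  refine ⟨T, hT, fun x hx => ?_⟩
  by_contra! hcon
  have : ThreeCycleFree G (insert x T) := by
    intro a ha b hb c hc hab hbc hac h
    have h1 := h.rotate hab hbc hac
    have h2 := h1.rotate hbc hac.symm hab.symm
    rw [Finset.mem_insert] at ha hb hc
    rcases ha with rfl | ha
    · exact hcon b (hb.resolve_left hab.symm) c (hc.resolve_left hac.symm) hbc h1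
    · rcases hb with rfl | hb
      · exact hcon c (hc.resolve_left hbc.symm) a ha hac.symm h2
      · rcases hc with rfl | hc
        · exact hcon a ha b hb hab h
        · exact hT a ha b hb c hc hab hbc hac h
  have := hmax _ (Finset.mem_filter.2 ⟨Finset.mem_univ _, this⟩)
  rw [Finset.card_insert_of_notMem hx] at this
  omega

theorem exists_threeCycleClosed_of_lt {T : Finset D} {K : ℕ}
    (hT : ∀ x ∉ T, ∃ a ∈ T, ∃ b ∈ T, a ≠ b ∧ HasThreeCycle G a b x)
    (hcard : T.card + T.card * T.card * K < Fintype.card D) :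
    ∃ C : Finset D, ThreeCycleClosed G C ∧ K ≤ C.card := by
  classical
  choose! f hf g hg hfg h using hT
  obtain ⟨⟨a, b⟩, hab, hlt⟩ := Finset.exists_lt_card_fiber_of_mul_lt_card_of_maps_to
    (s := Tᶜ) (t := T ×ˢ T) (f := fun x => (f x, g x)) (n := K)
    (fun x hx => Finset.mem_product.2
      ⟨hf x (Finset.mem_compl.1 hx), hg x (Finset.mem_compl.1 hx)⟩)
    (by rw [Finset.card_product, Finset.card_compl]; omega)
  obtain ⟨x₀, hx₀⟩ := Finset.card_pos.1 (Nat.zero_lt_of_lt hlt)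
  have hne : a ≠ b := by
    simp only [Finset.mem_filter, Finset.mem_compl, Prod.mk.injEq] at hx₀
    obtain ⟨hx₀, rfl, rfl⟩ := hx₀
    exact hfg x₀ hx₀
  refine ⟨_, threeCycleClosed_of_star hne fun x hx _ _ => ?_, hlt.le⟩
  simp only [Finset.mem_filter, Finset.mem_compl, Prod.mk.injEq] at hx
  obtain ⟨hx, rfl, rfl⟩ := hx
  exact h x hx

/-- A group all of whose elements fixing `y ∈ C` stabilise `C` is small. -/
theorem card_le_of_stabilizer {C : Finset D} {y : D} (hy : y ∈ C)
    (h : ∀ g ∈ G, g y = y → ∀ x, g x ∈ C ↔ x ∈ C) :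
    Nat.card G ≤ Fintype.card D *
      ((C.card - 1).factorial * (Fintype.card D - C.card).factorial) := by
  have hstab : ∀ g : MulAction.stabilizer G y, (g : Perm D) y = y := fun g => g.2
  have h1 : ∀ g : MulAction.stabilizer G y, ∀ x, (g : Perm D) x ∈ C.erase y ↔ x ∈ C.erase y := by
    intro g x
    rw [Finset.mem_erase, Finset.mem_erase, h _ g.1.2 (hstab g)]
    refine and_congr_left fun _ => not_congr ⟨fun e => ?_, fun e => ?_⟩
    · exact (g : Perm D).injective (e.trans (hstab g).symm)
    · rw [e, hstab]
  have h2 : ∀ g : MulAction.stabilizer G y, ∀ x, (g : Perm D) x ∈ Cᶜ ↔ x ∈ Cᶜ := by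
    intro g x
    rw [Finset.mem_compl, Finset.mem_compl, h _ g.1.2 (hstab g)]
  -- The stabilizer of y embeds in Sym(C \ {y}) × Sym(D \ C).
  have hinj : Function.Injective (fun g : MulAction.stabilizer G y =>
      ((g : Perm D).subtypePerm (p := (· ∈ C.erase y)) (h1 g),
        (g : Perm D).subtypePerm (p := (· ∈ Cᶜ)) (h2 g))) := by
    intro g g' e
    simp only [Prod.mk.injEq] at e
    refine Subtype.ext (Subtype.ext (Perm.ext fun x => ?_))
    by_cases hxy : x = y
    · rw [hxy, hstab, hstab]
    · by_cases hx : x ∈ C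
      · exact congrArg Subtype.val (DFunLike.congr_fun e.1 ⟨x, Finset.mem_erase.2 ⟨hxy, hx⟩⟩)
      · exact congrArg Subtype.val (DFunLike.congr_fun e.2 ⟨x, Finset.mem_compl.2 hx⟩)
  have hcard := Nat.card_le_card_of_injective _ hinj
  rw [Nat.card_prod, Nat.card_eq_fintype_card (α := Perm _),
    Nat.card_eq_fintype_card (α := Perm _), Fintype.card_perm, Fintype.card_perm,
    Fintype.card_coe, Fintype.card_coe, Finset.card_erase_of_mem hy, Finset.card_compl] at hcard
  rw [← Subgroup.card_mul_index (MulAction.stabilizer G y), mul_comm, MulAction.index_stabilizer]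
  refine Nat.mul_le_mul ?_ hcard
  rw [← Nat.card_eq_fintype_card, ← Set.ncard_univ]
  exact Set.ncard_le_ncard (Set.subset_univ _)

end Counting

/-! ### Numerical estimates -/

section Estimates

theorem choose_le_choose_of_le_of_add_le {m r j : ℕ} (hrj : r ≤ j) (hj : j + r ≤ m) :
    m.choose r ≤ m.choose j := by
  have key : ∀ i, r ≤ i → 2 * i ≤ m → m.choose r ≤ m.choose i := by
    intro i hi
    induction i, hi using Nat.le_induction with
    | base => exact fun _ => le_rfl
    | succ i _ ih =>
      exact fun h => (ih (by omega)).trans (Nat.choose_le_succ_of_lt_half_left (by omega))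
  by_cases h : 2 * j ≤ m
  · exact key j hrj h
  · rw [← Nat.choose_symm (show j ≤ m by omega)]
    exact key (m - j) (by omega) (by omega)

/-- The binomial has degree k+1 in n: its numerator has k+1 factors, each at least n/2. -/
theorem pow_lt_choose_sub_one {k n : ℕ} (hn : 2 ^ (k + 1) * (k + 1).factorial < n)
    (hk : 2 * (k + 1) ≤ n) : n ^ k < (n - 1).choose (k + 1) := by
  have h1 := Nat.pow_sub_le_descFactorial (n - 1) (k + 1)
  rw [Nat.descFactorial_eq_factorial_mul_choose] at h1
  have h2 : n ^ (k + 1) ≤ 2 ^ (k + 1) * (n - 1 + 1 - (k + 1)) ^ (k + 1) := by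
    rw [← mul_pow]
    exact Nat.pow_le_pow_left (by omega) _
  have h3 : n ^ k * (2 ^ (k + 1) * (k + 1).factorial) < n ^ (k + 1) := by
    rw [pow_succ]
    exact Nat.mul_lt_mul_of_pos_left hn (pow_pos (by omega) _)
  have h4 : 2 ^ (k + 1) * (k + 1).factorial * n ^ k <
      2 ^ (k + 1) * (k + 1).factorial * (n - 1).choose (k + 1) := by
    calc _ = n ^ k * (2 ^ (k + 1) * (k + 1).factorial) := mul_comm _ _
      _ < n ^ (k + 1) := h3
      _ ≤ _ := h2
      _ ≤ _ := Nat.mul_le_mul_left _ h1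
      _ = _ := (mul_assoc _ _ _).symm
  exact lt_of_mul_lt_mul_left' h4

theorem exists_forall_pow_lt_factorial (c k : ℕ) :
    ∃ w₀ : ℕ, ∀ w ≥ w₀, (c * w ^ 2) ^ k < w.factorial := by
  refine ⟨2 ^ (2 * k + 1) * c ^ k + 4 * k + 1, fun w hw => ?_⟩
  have h1 : (w + 1 - (2 * k + 1)) ^ (2 * k + 1) ≤ w.factorial :=
    (Nat.pow_sub_le_descFactorial w (2 * k + 1)).trans 
      (Nat.le_of_dvd (Nat.factorial_pos _) ⟨_, ((Nat.mul_comm _ _).trans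
        (Nat.factorial_mul_descFactorial (by omega))).symm⟩)
  have h2 : w ^ (2 * k + 1) ≤ 2 ^ (2 * k + 1) * (w + 1 - (2 * k + 1)) ^ (2 * k + 1) := by
    rw [← mul_pow]
    exact Nat.pow_le_pow_left (by omega) _
  have h3 : 2 ^ (2 * k + 1) * (c * w ^ 2) ^ k < w ^ (2 * k + 1) := by
    have : 2 ^ (2 * k + 1) * (c * w ^ 2) ^ k = w ^ (2 * k) * (2 ^ (2 * k + 1) * c ^ k) := by
      rw [mul_pow, ← pow_mul]; ring
    rw [this, pow_succ w]
    exact Nat.mul_lt_mul_of_pos_left (by omega) (pow_pos (by omega) _)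
  exact lt_of_mul_lt_mul_left'
    (h3.trans_le (h2.trans (Nat.mul_le_mul_left _ h1)))

end Estimates

/-! ### Maximal closed sets and the main theorem -/

theorem ThreeCycleClosed.mem_iff_of_maximal {D : Type*} [DecidableEq D]
    {G : Subgroup (Perm D)} {C : Finset D} (hC : ThreeCycleClosed G C) (h3 : 3 ≤ C.card)
    (hmax : ∀ x ∉ C, ¬ ThreeCycleClosed G (insert x C)) {g : Perm D} (hg : g ∈ G) {y : D}
    (hy : y ∈ C) (hgy : g y ∈ C) (x : D) : g x ∈ C ↔ x ∈ C := by
  have key : ∀ {g : Perm D}, g ∈ G → ∀ {y}, y ∈ C → g y ∈ C → ∀ x ∈ C, g x ∈ C := by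
    intro g hg y hy hgy x hx
    by_contra hgx
    exact hmax _ hgx (hC.exists_insert (hC.map hg) h3 (by rwa [Finset.card_map]) hgy
      (Finset.mem_map_of_mem _ hy) (Finset.mem_map_of_mem _ hx) hgx)
  refine ⟨fun h => ?_, key hg hy hgy x⟩
  simpa using key (G.inv_mem hg) hgy (by simpa using hy) (g x) h

theorem lemma7p7 (k : ℕ) :
    ∃ N : ℕ, k ≤ N ∧
      ∀ (D : Type*) [Fintype D] [DecidableEq D] (G : Subgroup (Equiv.Perm D)),
        N ≤ Fintype.card D →
        (Fintype.card D - k).factorial ≤ Nat.card G →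
        ∃ Δ : Finset D, IsFixedSet G Δ ∧ Fintype.card D - k ≤ Δ.card ∧
          alternatingGroup Δ ≤ inducedGroup G Δ := by
  -- The constant comes from n ≤ |T| + (k+3)|T|² with |T| ≤ 2w.
  obtain ⟨w₀, hw₀⟩ := exists_forall_pow_lt_factorial (2 + 4 * (k + 3)) k
  refine ⟨(2 + 4 * (k + 3)) * w₀ ^ 2 + 2 ^ (k + 1) * (k + 1).factorial + 2 * (k + 1) + 1,
    by omega, ?_⟩
  intro D _ _ G hN hG
  set n := Fintype.card D with hn
  have hfact : n.factorial = (n - k).factorial * n.descFactorial k :=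
    (Nat.factorial_mul_descFactorial (by omega)).symm
  have hdesc : n.descFactorial k ≤ n ^ k := Nat.descFactorial_le_pow n k
  have hpos : 0 < (n - k).factorial := Nat.factorial_pos _
  -- Size k+3 ensures both |C| ≥ 3 and |C|-1 ≥ k+1, as the enlargement and binomial bounds require.
  obtain ⟨C₀, hC₀, hcard₀⟩ : ∃ C : Finset D, ThreeCycleClosed G C ∧ k + 3 ≤ C.card := by
    obtain ⟨T, hTfree, hT⟩ := exists_threeCycleFree_forall_notMem G
    refine exists_threeCycleClosed_of_lt hT ?_
    obtain ⟨W, -, hTW, hW⟩ := hTfree.exists_subset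
    by_contra! hle
    have hnw : n ≤ (2 + 4 * (k + 3)) * W.card ^ 2 := by
      have : T.card * T.card * (k + 3) ≤ (2 * W.card) * (2 * W.card) * (k + 3) := by gcongr
      nlinarith [Nat.le_self_pow two_ne_zero W.card]
    have hw : w₀ ≤ W.card := by
      by_contra! hlt
      have : W.card ^ 2 ≤ w₀ ^ 2 := Nat.pow_le_pow_left hlt.le 2
      have := Nat.mul_le_mul_left (2 + 4 * (k + 3)) this
      omega
    have h1 : n ^ k < W.card.factorial :=
      (Nat.pow_le_pow_left hnw k).trans_lt (hw₀ _ hw)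
    have h2 := (Nat.mul_le_mul_right _ hG).trans (card_mul_factorial_le hW)
    rw [← hn, hfact] at h2
    exact absurd (Nat.le_of_mul_le_mul_left h2 hpos) (by omega)
  classical
  obtain ⟨C, hCS, hCmax⟩ := (Finset.univ.filter fun C : Finset D => ThreeCycleClosed G C)
    |>.exists_max_image Finset.card ⟨C₀, by simpa using hC₀⟩
  have hC : ThreeCycleClosed G C := by simpa using hCS
  have hkC : k + 3 ≤ C.card := hcard₀.trans (hCmax _ (by simpa using hC₀))
  have hCn : C.card ≤ n := Finset.card_le_univ C
  have hmax : ∀ x ∉ C, ¬ ThreeCycleClosed G (insert x C) := by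
    intro x hx h
    have := hCmax _ (by simpa using h)
    rw [Finset.card_insert_of_notMem hx] at this
    omega
  have hmem : ∀ {g : Perm D}, g ∈ G → ∀ {y}, y ∈ C → g y ∈ C → ∀ x, g x ∈ C ↔ x ∈ C :=
    fun hg _ hy hgy => hC.mem_iff_of_maximal (by omega) hmax hg hy hgy
  have hlarge : n - k ≤ C.card := by
    by_contra! hlt
    obtain ⟨y, hy⟩ := Finset.card_pos.1 (show 0 < C.card by omega)
    have h1 := hG.trans (card_le_of_stabilizer hy fun g hg e => hmem hg hy (e.symm ▸ hy))
    rw [← hn] at h1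
    have h2 : n.factorial = (n - 1).choose (C.card - 1) *
        (n * ((C.card - 1).factorial * (n - C.card).factorial)) := by
      rw [← Nat.mul_factorial_pred (show n ≠ 0 by omega),
        ← Nat.choose_mul_factorial_mul_factorial (show C.card - 1 ≤ n - 1 by omega),
        show n - 1 - (C.card - 1) = n - C.card by omega]
      ring
    have h3 : n ^ k < (n - 1).choose (C.card - 1) :=
      (pow_lt_choose_sub_one (by omega) (by omega)).trans_le
        (choose_le_choose_of_le_of_add_le (by omega) (by omega))
    have h4 := Nat.mul_le_mul_left ((n - 1).choose (C.card - 1)) h1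
    rw [← h2, hfact, mul_comm] at h4
    exact absurd (Nat.le_of_mul_le_mul_left h4 hpos) (by omega)
  refine ⟨C, fun g hg => ?_, hlarge, hC.alternatingGroup_le_inducedGroup⟩
  -- As `C` contains more than half of the points, it meets its image under `g`.
  obtain ⟨y, hy⟩ : (C.map g.toEmbedding ∩ C).Nonempty := by
    rw [← Finset.not_disjoint_iff_nonempty_inter]
    intro hdisj
    have := Finset.card_le_univ (C.map g.toEmbedding ∪ C)
    rw [Finset.card_union_of_disjoint hdisj, Finset.card_map] at this
    omega
  obtain ⟨hy₁, hy₂⟩ := Finset.mem_inter.1 hy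
  obtain ⟨y, hyC, rfl⟩ := Finset.mem_map.1 hy₁
  exact fun x hx => (hmem hg hyC hy₂ x).2 hx
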